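/- Let $q\in\mathbb{C}$ with $q\neq 0$ and $|q|<1$. For a nonnegative integer $n$ put $[n]_q=\frac{1-q^n}{1-q}$, and for $a,p\in\mathbb{C}$ with $|p|<1$ put $(a;p)_n=\prod_{i=0}^{n-1}(1-ap^i)$ and $(a;p)_\infty=\prod_{i=0}^{\infty}(1-ap^i)$. Then the series below converges (absolutely) and \[ \sum_{k=0}^{\infty}q^{\frac{k^2+5k+2}{2}}\,\frac{[3k+4]_q}{[2k+3]_q^2}\cdot\frac{(q;q)_k^3\,(-q;q)_k}{(q^3;q^2)_k^3} =(1-q)^2\,\frac{(q^2;q^2)_\infty^4}{(q;q^2)_\infty^4}-(1+q). \] -/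

import Mathlib

noncomputable section

/-- The `q`-analogue `[n]_q = (1 - q ^ n) / (1 - q)` of the natural number `n`. -/
def qNumber (q : ℂ) (n : ℕ) : ℂ := (1 - q ^ n) / (1 - q)

/-- The finite `q`-shifted factorial `(a; q)_n = ∏_{i < n} (1 - a q ^ i)`. -/
def qPochhammer (a q : ℂ) (n : ℕ) : ℂ := ∏ i ∈ Finset.range n, (1 - a * q ^ i)

/-- The infinite `q`-shifted factorial `(a; q)_∞ = ∏_{i ≥ 0} (1 - a q ^ i)`. -/
def qPochhammerInf (a q : ℂ) : ℂ := ∏' i : ℕ, (1 - a * q ^ i)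

/-- For `‖q‖ < 1` the product defining `(a; q)_∞` converges. -/
theorem multipliable_qPochhammerInf (a : ℂ) {q : ℂ} (hq : ‖q‖ < 1) :
    Multipliable (fun i : ℕ => 1 - a * q ^ i) := by
  have h : Summable (fun i : ℕ => ‖-(a * q ^ i)‖) := by
    simpa [norm_mul, norm_pow] using
      (summable_geometric_of_lt_one (norm_nonneg q) hq).mul_left ‖a‖
  simpa [sub_eq_add_neg] using multipliable_one_add_of_summable h

/-- For `‖q‖ < 1` the finite factorial satisfies `(a; q)_∞ = (a; q)_n (a q ^ n; q)_∞`. -/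
theorem qPochhammer_mul_qPochhammerInf (a : ℂ) {q : ℂ} (hq : ‖q‖ < 1) (n : ℕ) :
    qPochhammer a q n * qPochhammerInf (a * q ^ n) q = qPochhammerInf a q := by
  have hs : Multipliable (fun i : ℕ => 1 - a * q ^ (i + n)) := by
    refine (multipliable_qPochhammerInf (a * q ^ n) hq).congr fun i => ?_
    rw [pow_add]; ring
  have h := hs.prod_mul_tprod_nat_mul' (f := fun i : ℕ => 1 - a * q ^ i)
  rw [qPochhammer, qPochhammerInf, qPochhammerInf, ← h]
  congr 1
  refine tprod_congr fun i => ?_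
  rw [pow_add]; ring

end

open Filter Topology

/-!
The series is an accelerated form of the Lambert series
`Λ = ∑_{m ≥ 0} q^m (1 + q^{2m+1}) / (1 - q^{2m+1})²`, and `Λ = (q²;q²)_∞⁴ / (q;q²)_∞⁴`.

*Acceleration.* The functions `wzF` and `wzG` form a WZ pair:
`F(n, m) - F(n, m+1) = G(n, m) - G(n+1, m)` (`wzF_sub_wzF`), where `G(0, m)` is the `m`-th term of
`Λ`. Both decay geometrically, so summing over `n` gives
`∑_n F(n, m) - ∑_n F(n, m+1) = G(0, m)` (`tsum_wzF_sub`), and summing this over `m` gives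
`∑_n F(n, 0) = Λ`. The series in question is `(1 - q)² ∑_n F(n, 1)` (`wzF_one`), that is,
`(1 - q)² Λ` without the contribution `1 + q` of the term `m = 0`.

*Product formula.* `Λ` is a very-well-poised `₆φ₅` series in base `q²`. Put it in a family `f(w)`
(`wellPoisedTerm`) with `(1 - q) Λ = f(1)`. A telescoping argument (`wellPoised_telescope`) gives
`f(w) (1 - q³w) (1 - qw) = f(q²w) (1 - q²w)²`, and iterating this with `q^{2M} w → 0` expresses
`f(w)` through `f(0)` and infinite products (`wellPoised_eq`). The sum `f(q)` has a single nonzero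
term, which determines `f(0)` and hence `f(1)` (`tsum_lambertTerm`).
-/

/-! ### Finite and infinite `q`-shifted factorials -/

theorem qPochhammer_zero (a p : ℂ) : qPochhammer a p 0 = 1 := by simp [qPochhammer]

theorem qPochhammer_succ (a p : ℂ) (n : ℕ) :
    qPochhammer a p (n + 1) = qPochhammer a p n * (1 - a * p ^ n) := by
  simp [qPochhammer, Finset.prod_range_succ]

theorem qPochhammer_add (a p : ℂ) (m n : ℕ) :
    qPochhammer a p (m + n) = qPochhammer a p m * qPochhammer (a * p ^ m) p n := by
  simp only [qPochhammer, Finset.prod_range_add, pow_add, mul_assoc]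

theorem qPochhammer_succ' (a p : ℂ) (n : ℕ) :
    qPochhammer a p (n + 1) = (1 - a) * qPochhammer (a * p) p n := by
  rw [add_comm, qPochhammer_add]; simp [qPochhammer]

theorem qPochhammer_ne_zero {a p : ℂ} (h : ∀ i : ℕ, 1 - a * p ^ i ≠ 0) (n : ℕ) :
    qPochhammer a p n ≠ 0 := Finset.prod_ne_zero_iff.2 fun i _ => h i

theorem tendsto_qPochhammer (a : ℂ) {p : ℂ} (hp : ‖p‖ < 1) :
    Tendsto (qPochhammer a p) atTop (𝓝 (qPochhammerInf a p)) :=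
  (multipliable_qPochhammerInf a hp).tendsto_prod_tprod_nat

theorem qPochhammerInf_ne_zero {a p : ℂ} (hp : ‖p‖ < 1) (h : ∀ i : ℕ, 1 - a * p ^ i ≠ 0) :
    qPochhammerInf a p ≠ 0 := by
  have hs : Summable (fun i : ℕ => ‖-(a * p ^ i)‖) := by
    simpa [norm_mul, norm_pow] using
      (summable_geometric_of_lt_one (norm_nonneg p) hp).mul_left ‖a‖
  have := tprod_one_add_ne_zero_of_summable (f := fun i : ℕ => -(a * p ^ i))
    (fun i => by simpa [sub_eq_add_neg] using h i) hs
  simpa [qPochhammerInf, sub_eq_add_neg] using this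

theorem exists_norm_le_of_tendsto {u : ℕ → ℂ} {l : ℂ} (h : Tendsto u atTop (𝓝 l)) :
    ∃ C : ℝ, 0 < C ∧ ∀ n, ‖u n‖ ≤ C := by
  obtain ⟨C, hC, h⟩ := (Metric.isBounded_range_of_tendsto u h).exists_pos_norm_le
  exact ⟨C, hC, fun n => h _ ⟨n, rfl⟩⟩

theorem exists_norm_qPochhammer_le (a : ℂ) {p : ℂ} (hp : ‖p‖ < 1) :
    ∃ C : ℝ, 0 < C ∧ ∀ n, ‖qPochhammer a p n‖ ≤ C :=
  exists_norm_le_of_tendsto (tendsto_qPochhammer a hp)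

theorem exists_norm_inv_qPochhammer_le {a p : ℂ} (hp : ‖p‖ < 1) (h : ∀ i : ℕ, 1 - a * p ^ i ≠ 0) :
    ∃ C : ℝ, 0 < C ∧ ∀ n, ‖(qPochhammer a p n)⁻¹‖ ≤ C :=
  exists_norm_le_of_tendsto ((tendsto_qPochhammer a hp).inv₀ (qPochhammerInf_ne_zero hp h))

/-- The bound is uniform in the shift because `(a p ^ m; p)_n = (a; p)_{m+n} / (a; p)_m`. -/
theorem exists_norm_inv_qPochhammer_shift_le {a p : ℂ} (hp : ‖p‖ < 1)
    (h : ∀ i : ℕ, 1 - a * p ^ i ≠ 0) :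
    ∃ C : ℝ, 0 < C ∧ ∀ m n, ‖(qPochhammer (a * p ^ m) p n)⁻¹‖ ≤ C := by
  obtain ⟨C, hC, h1⟩ := exists_norm_qPochhammer_le a hp
  obtain ⟨D, hD, h2⟩ := exists_norm_inv_qPochhammer_le hp h
  refine ⟨C * D, by positivity, fun m n => ?_⟩
  have : (qPochhammer (a * p ^ m) p n)⁻¹
      = qPochhammer a p m * (qPochhammer a p (m + n))⁻¹ := by
    rw [qPochhammer_add, mul_inv, mul_inv_cancel_left₀ (qPochhammer_ne_zero h m)]
  rw [this, norm_mul]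
  exact mul_le_mul (h1 m) (h2 _) (norm_nonneg _) hC.le

theorem one_sub_ne_zero_of_norm_lt_one {x : ℂ} (hx : ‖x‖ < 1) : 1 - x ≠ 0 := by
  rintro h
  rw [← sub_eq_zero.1 h] at hx
  simp at hx

theorem one_sub_pow_ne_zero {q : ℂ} (hq : ‖q‖ < 1) {n : ℕ} (hn : n ≠ 0) : 1 - q ^ n ≠ 0 :=
  one_sub_ne_zero_of_norm_lt_one (by rw [norm_pow]; exact pow_lt_one₀ (norm_nonneg _) hq hn)

theorem norm_sq_lt_one {q : ℂ} (hq : ‖q‖ < 1) : ‖q ^ 2‖ < 1 := by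
  rw [norm_pow]; exact pow_lt_one₀ (norm_nonneg _) hq two_ne_zero

/-! ### Acceleration of the Lambert series -/

/-- The common factor `q^{m(2n+1)} q^{n(n+1)/2} (q;q)_n² (q²;q²)_n / ((q³;q²)_n (q^{2m+1};q²)²_{n+1})`
of the two members of the WZ pair. -/
noncomputable def wzKernel (q : ℂ) (n m : ℕ) : ℂ :=
  q ^ (m * (2 * n + 1) + n * (n + 1) / 2) * qPochhammer q q n ^ 2 * qPochhammer (q ^ 2) (q ^ 2) n /
    (qPochhammer (q ^ 3) (q ^ 2) n * qPochhammer (q * (q ^ 2) ^ m) (q ^ 2) (n + 1) ^ 2)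

/-- The WZ member which is summed over `n`; at `m = 1` it is the accelerated series. -/
noncomputable def wzF (q : ℂ) (n m : ℕ) : ℂ := wzKernel q n m * (1 - q ^ (3 * n + 2 * m + 2)) / (1 - q)

/-- The WZ companion of `wzF`; at `n = 0` it is the Lambert series. -/
noncomputable def wzG (q : ℂ) (n m : ℕ) : ℂ :=
  wzKernel q n m * (1 - q ^ (2 * n + 1)) * (1 + q ^ (n + 2 * m + 1)) / (1 - q)

/-- The term `q^m (1 + q^{2m+1}) / (1 - q^{2m+1})²` of the Lambert series. -/
noncomputable def lambertTerm (q : ℂ) (m : ℕ) : ℂ := q ^ m * (1 + q ^ (2 * m + 1)) / (1 - q ^ (2 * m + 1)) ^ 2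

theorem odd_factor_ne_zero {q : ℂ} (hq : ‖q‖ < 1) (i : ℕ) : 1 - q * (q ^ 2) ^ i ≠ 0 := by
  rw [← pow_mul, ← pow_succ']; exact one_sub_pow_ne_zero hq (by omega)

theorem odd_factor_ne_zero' {q : ℂ} (hq : ‖q‖ < 1) (i : ℕ) : 1 - q ^ 3 * (q ^ 2) ^ i ≠ 0 := by
  rw [← pow_mul, ← pow_add]; exact one_sub_pow_ne_zero hq (by omega)

theorem triangle_succ (n : ℕ) : (n + 1) * (n + 1 + 1) / 2 = n * (n + 1) / 2 + (n + 1) := by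
  rw [show (n + 1) * (n + 1 + 1) = n * (n + 1) + (n + 1) * 2 by ring,
    Nat.add_mul_div_right _ _ two_pos]

theorem wzG_zero {q : ℂ} (hq : ‖q‖ < 1) (m : ℕ) : wzG q 0 m = lambertTerm q m := by
  have h1 : 1 - q ≠ 0 := one_sub_ne_zero_of_norm_lt_one hq
  have : q * (q ^ 2) ^ m = q ^ (2 * m + 1) := by rw [← pow_mul, ← pow_succ']
  simp only [wzG, wzKernel, lambertTerm, qPochhammer_zero, qPochhammer_succ, this]
  simp
  field_simp

/-- The WZ relation. -/
theorem wzF_sub_wzF {q : ℂ} (hq : ‖q‖ < 1) (n m : ℕ) :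
    wzF q n m - wzF q n (m + 1) = wzG q n m - wzG q (n + 1) m := by
  have h1 : 1 - q ≠ 0 := one_sub_ne_zero_of_norm_lt_one hq
  have hs : qPochhammer (q * (q ^ 2) ^ m) (q ^ 2) (n + 1) ≠ 0 := by
    refine qPochhammer_ne_zero (fun i => ?_) _
    rw [mul_assoc, ← pow_add]; exact odd_factor_ne_zero hq _
  have hB : qPochhammer (q ^ 3) (q ^ 2) n ≠ 0 := qPochhammer_ne_zero (odd_factor_ne_zero' hq) n
  have hb : 1 - q ^ 3 * (q ^ 2) ^ n ≠ 0 := odd_factor_ne_zero' hq n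
  have hx : 1 - q * (q ^ 2) ^ m ≠ 0 := odd_factor_ne_zero hq m
  have hy : 1 - q * (q ^ 2) ^ m * (q ^ 2) ^ (n + 1) ≠ 0 := by
    rw [mul_assoc, ← pow_add]; exact odd_factor_ne_zero hq _
  -- `(q^{2m+3}; q²)_{n+1} = (q^{2m+1}; q²)_{n+1} (1 - q^{2m+2n+3}) / (1 - q^{2m+1})`
  have hshift : qPochhammer (q * (q ^ 2) ^ (m + 1)) (q ^ 2) (n + 1)
      = qPochhammer (q * (q ^ 2) ^ m) (q ^ 2) (n + 1) *
        (1 - q * (q ^ 2) ^ m * (q ^ 2) ^ (n + 1)) / (1 - q * (q ^ 2) ^ m) := by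
    rw [eq_div_iff hx, ← qPochhammer_succ, qPochhammer_succ' _ _ (n + 1), pow_succ (q ^ 2) m,
      mul_assoc q]
    ring
  simp only [wzF, wzG, wzKernel]
  rw [hshift, qPochhammer_succ _ _ (n + 1), qPochhammer_succ q q n, qPochhammer_succ (q ^ 2),
    qPochhammer_succ (q ^ 3), triangle_succ]
  generalize qPochhammer (q * (q ^ 2) ^ m) (q ^ 2) (n + 1) = S at *
  generalize qPochhammer (q ^ 3) (q ^ 2) n = B at *
  generalize qPochhammer q q n = A
  generalize qPochhammer (q ^ 2) (q ^ 2) n = D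
  have e1 : q ^ (m * (2 * n + 1) + n * (n + 1) / 2)
      = q ^ (m * (2 * n + 1)) * q ^ (n * (n + 1) / 2) := pow_add _ _ _
  have e2 : q ^ ((m + 1) * (2 * n + 1) + n * (n + 1) / 2)
      = q ^ (m * (2 * n + 1)) * q ^ (n * (n + 1) / 2) * (q * (q ^ n) ^ 2) := by ring
  have e3 : q ^ (m * (2 * (n + 1) + 1) + (n * (n + 1) / 2 + (n + 1)))
      = q ^ (m * (2 * n + 1)) * q ^ (n * (n + 1) / 2) * ((q ^ m) ^ 2 * q ^ n * q) := by ring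
  have e4 : q ^ (3 * n + 2 * m + 2) = (q ^ n) ^ 3 * (q ^ m) ^ 2 * q ^ 2 := by ring
  have e5 : q ^ (3 * n + 2 * (m + 1) + 2) = (q ^ n) ^ 3 * (q ^ m) ^ 2 * q ^ 4 := by ring
  have e6 : q ^ (2 * n + 1) = (q ^ n) ^ 2 * q := by ring
  have e7 : q ^ (n + 2 * m + 1) = q ^ n * (q ^ m) ^ 2 * q := by ring
  have e8 : q ^ (2 * (n + 1) + 1) = (q ^ n) ^ 2 * q ^ 3 := by ring
  have e9 : q ^ (n + 1 + 2 * m + 1) = q ^ n * (q ^ m) ^ 2 * q ^ 2 := by ring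
  have e10 : (q ^ 2) ^ n = (q ^ n) ^ 2 := by ring
  have e11 : (q ^ 2) ^ m = (q ^ m) ^ 2 := by ring
  have e12 : (q ^ 2) ^ (n + 1) = (q ^ n) ^ 2 * q ^ 2 := by ring
  rw [e1, e2, e3, e4, e5, e6, e7, e8, e9, e10, e11, e12]
  rw [e10] at hb
  rw [e11] at hx
  have e13 : q * (q ^ m) ^ 2 * ((q ^ n) ^ 2 * q ^ 2) = q ^ 3 * (q ^ m) ^ 2 * (q ^ n) ^ 2 := by ring
  rw [e11, e12, e13] at hy
  rw [e13]
  generalize q ^ (m * (2 * n + 1)) * q ^ (n * (n + 1) / 2) = E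
  generalize q ^ n = y at *
  generalize q ^ m = x at *
  clear hshift e1 e2 e3 e4 e5 e6 e7 e8 e9 e10 e11 e12 e13
  generalize hv : 1 - q ^ 3 * x ^ 2 * y ^ 2 = v at *
  generalize hu : 1 - q ^ 3 * y ^ 2 = u at *
  generalize ht : 1 - q * x ^ 2 = t at *
  field_simp
  rw [← hv, ← hu, ← ht]
  ring

/-- The common factor of the WZ pair, hence each member, decays geometrically in both variables. -/
theorem exists_norm_wzKernel_le {q : ℂ} (hq : ‖q‖ < 1) :
    ∃ C : ℝ, 0 < C ∧ ∀ n m, ‖wzKernel q n m‖ ≤ C * ‖q‖ ^ m * ‖q‖ ^ n := by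
  have hp := norm_sq_lt_one hq
  obtain ⟨A, hA, hA'⟩ := exists_norm_qPochhammer_le q hq
  obtain ⟨D, hD, hD'⟩ := exists_norm_qPochhammer_le (q ^ 2) hp
  obtain ⟨B, hB, hB'⟩ := exists_norm_inv_qPochhammer_le hp (odd_factor_ne_zero' hq)
  obtain ⟨S, hS, hS'⟩ := exists_norm_inv_qPochhammer_shift_le hp (odd_factor_ne_zero hq)
  refine ⟨A ^ 2 * D * (B * S ^ 2), by positivity, fun n m => ?_⟩
  rw [wzKernel, div_eq_mul_inv, mul_inv, ← inv_pow]
  simp only [norm_mul, norm_pow]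
  have hpow : ‖q‖ ^ (m * (2 * n + 1) + n * (n + 1) / 2) ≤ ‖q‖ ^ m * ‖q‖ ^ n := by
    rw [← pow_add]
    refine pow_le_pow_of_le_one (norm_nonneg _) hq.le (add_le_add ?_ ?_)
    · nlinarith [Nat.zero_le (m * n)]
    · rw [Nat.le_div_iff_mul_le two_pos]
      rcases n with _ | n
      · simp
      · nlinarith
  calc _ ≤ (‖q‖ ^ m * ‖q‖ ^ n) * A ^ 2 * D * (B * S ^ 2) := by
        gcongr
        · exact hA' n
        · exact hD' n
        · exact hB' n
        · exact hS' m (n + 1)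
    _ = _ := by ring

theorem norm_one_sub_pow_le {q : ℂ} (hq : ‖q‖ < 1) (n : ℕ) : ‖1 - q ^ n‖ ≤ 2 := by
  refine (norm_sub_le _ _).trans ?_
  rw [norm_one, norm_pow]
  linarith [pow_le_one₀ (norm_nonneg q) hq.le (n := n)]

theorem norm_one_add_pow_le {q : ℂ} (hq : ‖q‖ < 1) (n : ℕ) : ‖1 + q ^ n‖ ≤ 2 := by
  refine (norm_add_le _ _).trans ?_
  rw [norm_one, norm_pow]
  linarith [pow_le_one₀ (norm_nonneg q) hq.le (n := n)]

theorem exists_norm_wzF_le {q : ℂ} (hq : ‖q‖ < 1) :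
    ∃ C : ℝ, 0 < C ∧ ∀ n m, ‖wzF q n m‖ ≤ C * ‖q‖ ^ m * ‖q‖ ^ n := by
  obtain ⟨C, hC, h⟩ := exists_norm_wzKernel_le hq
  have h1 : 0 < ‖1 - q‖ := norm_pos_iff.2 (one_sub_ne_zero_of_norm_lt_one hq)
  refine ⟨C * 2 / ‖1 - q‖, by positivity, fun n m => ?_⟩
  rw [wzF, norm_div, norm_mul]
  calc _ ≤ (C * ‖q‖ ^ m * ‖q‖ ^ n) * 2 / ‖1 - q‖ := by
        gcongr
        · exact h n m
        · exact norm_one_sub_pow_le hq _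
    _ = _ := by ring

theorem tendsto_wzG {q : ℂ} (hq : ‖q‖ < 1) (m : ℕ) :
    Tendsto (fun n => wzG q n m) atTop (𝓝 0) := by
  obtain ⟨C, hC, h⟩ := exists_norm_wzKernel_le hq
  have h1 : 0 < ‖1 - q‖ := norm_pos_iff.2 (one_sub_ne_zero_of_norm_lt_one hq)
  refine squeeze_zero_norm (a := fun n => C * ‖q‖ ^ m * 4 / ‖1 - q‖ * ‖q‖ ^ n) (fun n => ?_) ?_
  · rw [wzG, norm_div, norm_mul, norm_mul]
    calc _ ≤ (C * ‖q‖ ^ m * ‖q‖ ^ n) * 2 * 2 / ‖1 - q‖ := by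
          gcongr
          · exact h n m
          · exact norm_one_sub_pow_le hq _
          · exact norm_one_add_pow_le hq _
      _ = _ := by ring
  · simpa using (tendsto_pow_atTop_nhds_zero_of_lt_one (norm_nonneg q) hq).const_mul
      (C * ‖q‖ ^ m * 4 / ‖1 - q‖)

theorem summable_wzF {q : ℂ} (hq : ‖q‖ < 1) (m : ℕ) : Summable (fun n => wzF q n m) := by
  obtain ⟨C, hC, h⟩ := exists_norm_wzF_le hq
  exact Summable.of_norm_bounded
    ((summable_geometric_of_lt_one (norm_nonneg q) hq).mul_left (C * ‖q‖ ^ m)) fun n => h n m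

theorem tendsto_tsum_wzF {q : ℂ} (hq : ‖q‖ < 1) :
    Tendsto (fun m => ∑' n, wzF q n m) atTop (𝓝 0) := by
  obtain ⟨C, hC, h⟩ := exists_norm_wzF_le hq
  have hg := hasSum_geometric_of_lt_one (norm_nonneg q) hq
  refine squeeze_zero_norm (a := fun m => C * (1 - ‖q‖)⁻¹ * ‖q‖ ^ m) (fun m => ?_) ?_
  · have := tsum_of_norm_bounded (hg.mul_left (C * ‖q‖ ^ m)) fun n => h n m
    linarith
  · simpa using (tendsto_pow_atTop_nhds_zero_of_lt_one (norm_nonneg q) hq).const_mul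
      (C * (1 - ‖q‖)⁻¹)

/-- Summing the WZ relation over `n` leaves only the boundary term at `n = 0`. -/
theorem tsum_wzF_sub {q : ℂ} (hq : ‖q‖ < 1) (m : ℕ) :
    ∑' n, wzF q n m - ∑' n, wzF q n (m + 1) = lambertTerm q m := by
  rw [← (summable_wzF hq m).tsum_sub (summable_wzF hq (m + 1))]
  have hs := ((summable_wzF hq m).sub (summable_wzF hq (m + 1))).hasSum.tendsto_sum_nat
  refine tendsto_nhds_unique hs ?_
  simp only [wzF_sub_wzF hq, Finset.sum_range_sub', wzG_zero hq]
  simpa using (tendsto_wzG hq m).const_sub (lambertTerm q m)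

theorem tendsto_sum_lambertTerm {q : ℂ} (hq : ‖q‖ < 1) :
    Tendsto (fun N => ∑ j ∈ Finset.range N, lambertTerm q j) atTop (𝓝 (∑' n, wzF q n 0)) := by
  simp only [← tsum_wzF_sub hq, Finset.sum_range_sub' (fun j => ∑' n, wzF q n j)]
  simpa using (tendsto_tsum_wzF hq).const_sub (∑' n, wzF q n 0)

/-! ### The Lambert series as an infinite product -/

/-- The numerator `∏_{i<n} (w - q^{2i+1})`. It equals `w^n (q/w; q²)_n` for `w ≠ 0` and makes sense
at `w = 0` as well. -/
noncomputable def shiftedNum (q w : ℂ) (n : ℕ) : ℂ :=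
  ∏ i ∈ Finset.range n, (w - q * (q ^ 2) ^ i)

/-- The general term of a very-well-poised `₆φ₅` series in base `q²` with parameters
`(q²; q, q, q/w)`. -/
noncomputable def wellPoisedTerm (q w : ℂ) (n : ℕ) : ℂ :=
  q ^ n * (1 + q ^ (2 * n + 1)) / (1 - q ^ (2 * n + 1)) *
    (shiftedNum q w n / qPochhammer (q ^ 3 * w) (q ^ 2) n)

theorem shiftedNum_succ (q w : ℂ) (n : ℕ) :
    shiftedNum q w (n + 1) = shiftedNum q w n * (w - q * (q ^ 2) ^ n) := by
  simp [shiftedNum, Finset.prod_range_succ]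

theorem shiftedNum_mul_sq (q w : ℂ) (n : ℕ) :
    shiftedNum q (w * q ^ 2) (n + 1) = q ^ (2 * n + 1) * (q * w - 1) * shiftedNum q w n := by
  induction n with
  | zero => simp [shiftedNum]; ring
  | succ n ih => rw [shiftedNum_succ, ih, shiftedNum_succ]; ring

theorem shiftedNum_one (q : ℂ) (n : ℕ) : shiftedNum q 1 n = qPochhammer q (q ^ 2) n := rfl

theorem shiftedNum_self_succ (q : ℂ) (n : ℕ) : shiftedNum q q (n + 1) = 0 :=
  Finset.prod_eq_zero (i := 0) (by simp) (by simp)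

theorem exists_norm_shiftedNum_le {q : ℂ} (hq : ‖q‖ < 1) :
    ∃ C : ℝ, 0 < C ∧ ∀ w n, ‖w‖ ≤ 1 → ‖shiftedNum q w n‖ ≤ C := by
  have hp := norm_sq_lt_one hq
  obtain ⟨C, hC, h⟩ := exists_norm_qPochhammer_le (-(‖q‖ : ℂ)) (p := ((‖q ^ 2‖ : ℝ) : ℂ))
    (by simpa using hp)
  refine ⟨C, hC, fun w n hw => le_trans ?_ (h n)⟩
  rw [shiftedNum, qPochhammer, norm_prod, norm_prod]
  refine Finset.prod_le_prod (fun _ _ => norm_nonneg _) fun i _ => ?_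
  have e : (1 - -(‖q‖ : ℂ) * ((‖q ^ 2‖ : ℝ) : ℂ) ^ i) = ((1 + ‖q‖ * ‖q ^ 2‖ ^ i : ℝ) : ℂ) := by
    push_cast; ring
  rw [e, Complex.norm_real, Real.norm_of_nonneg (by positivity)]
  refine (norm_sub_le _ _).trans ?_
  rw [norm_mul, norm_pow]
  gcongr

/-- The `q²`-shift in `w` changes the series by a telescoping sum. -/
theorem wellPoised_telescope {q w : ℂ} (hq : ‖q‖ < 1)
    (hw : ∀ i : ℕ, 1 - q ^ 3 * w * (q ^ 2) ^ i ≠ 0) (N : ℕ) :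
    ∑ n ∈ Finset.range (N + 1), (wellPoisedTerm q w n * ((1 - q ^ 3 * w) * (1 - q * w))
        - wellPoisedTerm q (w * q ^ 2) n * (1 - q ^ 2 * w) ^ 2)
      = -(q ^ (N + 1) * w * (1 - q ^ 3 * w) * (1 - q ^ (2 * N + 2)) *
        (shiftedNum q w N / qPochhammer (q ^ 3 * w) (q ^ 2) (N + 1))) := by
  have hodd (n : ℕ) : 1 - q ^ (2 * n + 1) ≠ 0 := one_sub_pow_ne_zero hq (by omega)
  have h1 : 1 - q ≠ 0 := one_sub_ne_zero_of_norm_lt_one hq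
  have h0 : 1 - q ^ 3 * w ≠ 0 := by simpa using hw 0
  induction N with
  | zero =>
    simp [wellPoisedTerm, shiftedNum, qPochhammer]
    field_simp
    ring
  | succ N ih =>
    have hP := qPochhammer_ne_zero hw N
    have hN := hw N
    have hN1 := hw (N + 1)
    have ho := hodd (N + 1)
    have hshift : qPochhammer (q ^ 3 * (w * q ^ 2)) (q ^ 2) (N + 1)
        = qPochhammer (q ^ 3 * w) (q ^ 2) N * (1 - q ^ 3 * w * (q ^ 2) ^ N) *
          (1 - q ^ 3 * w * (q ^ 2) ^ (N + 1)) / (1 - q ^ 3 * w) := by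
      rw [eq_div_iff h0, ← qPochhammer_succ, ← qPochhammer_succ, qPochhammer_succ' _ _ (N + 1)]
      ring_nf
    rw [Finset.sum_range_succ, ih, wellPoisedTerm, wellPoisedTerm, shiftedNum_mul_sq, hshift,
      qPochhammer_succ _ _ (N + 1), qPochhammer_succ, shiftedNum_succ]
    generalize qPochhammer (q ^ 3 * w) (q ^ 2) N = P at *
    generalize shiftedNum q w N = A
    have e1 : q ^ (2 * (N + 1) + 1) = (q ^ N) ^ 2 * q ^ 3 := by ring
    have e2 : q ^ (2 * N + 1) = (q ^ N) ^ 2 * q := by ring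
    have e3 : q ^ (2 * N + 2) = (q ^ N) ^ 2 * q ^ 2 := by ring
    have e4 : q ^ (2 * (N + 1) + 2) = (q ^ N) ^ 2 * q ^ 4 := by ring
    have e5 : (q ^ 2) ^ N = (q ^ N) ^ 2 := by ring
    have e6 : (q ^ 2) ^ (N + 1) = (q ^ N) ^ 2 * q ^ 2 := by ring
    have e7 : q ^ 3 * w * ((q ^ N) ^ 2 * q ^ 2) = q ^ 5 * w * (q ^ N) ^ 2 := by ring
    have e8 : (q ^ N) ^ 2 * q ^ 3 = q ^ 3 * (q ^ N) ^ 2 := by ring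
    have e9 : q ^ (N + 1) = q ^ N * q := by ring
    have e10 : q ^ (N + 1 + 1) = q ^ N * q ^ 2 := by ring
    rw [e6, e7] at hN1
    rw [e5] at hN
    rw [e1, e8] at ho
    rw [e1, e2, e3, e4, e5, e6, e7, e8, e9, e10]
    clear ih hshift e1 e2 e3 e4 e5 e6 e7 e8 e9 e10
    generalize q ^ N = y at *
    generalize ht : 1 - q ^ 3 * w * y ^ 2 = t at *
    generalize hu : 1 - q ^ 5 * w * y ^ 2 = u at *
    generalize hv : 1 - q ^ 3 * y ^ 2 = v at *
    generalize hs : 1 - q ^ 3 * w = s at *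
    field_simp
    subst hv hu ht hs
    ring

/-- The values `w q^{2M}` share one bound, which makes the limit `M → ∞` dominated. -/
theorem exists_norm_wellPoisedTerm_le {q w : ℂ} (hq : ‖q‖ < 1) (hw1 : ‖w‖ ≤ 1)
    (hw : ∀ i : ℕ, 1 - q ^ 3 * w * (q ^ 2) ^ i ≠ 0) :
    ∃ C : ℝ, ∀ M n, ‖wellPoisedTerm q (w * (q ^ 2) ^ M) n‖ ≤ C * ‖q‖ ^ n := by
  have hp := norm_sq_lt_one hq
  obtain ⟨A, hA, hA'⟩ := exists_norm_shiftedNum_le hq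
  obtain ⟨B, hB, hB'⟩ := exists_norm_inv_qPochhammer_shift_le hp hw
  have hc : 0 < 1 - ‖q‖ := by linarith
  refine ⟨2 / (1 - ‖q‖) * (A * B), fun M n => ?_⟩
  have hwM : ‖w * (q ^ 2) ^ M‖ ≤ 1 := by
    rw [norm_mul, norm_pow]
    exact mul_le_one₀ hw1 (by positivity) (pow_le_one₀ (norm_nonneg _) hp.le)
  have hden : 1 - ‖q‖ ≤ ‖1 - q ^ (2 * n + 1)‖ := by
    have h := norm_sub_norm_le (1 : ℂ) (q ^ (2 * n + 1))
    rw [norm_one, norm_pow] at h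
    have := pow_le_of_le_one (norm_nonneg q) hq.le (n := 2 * n + 1) (by omega)
    linarith
  rw [wellPoisedTerm, div_eq_mul_inv (shiftedNum _ _ _), ← mul_assoc (q ^ 3)]
  simp only [norm_mul, norm_div, norm_pow]
  calc _ ≤ ‖q‖ ^ n * 2 / (1 - ‖q‖) * (A * B) := by
        gcongr
        · exact norm_one_add_pow_le hq _
        · exact hA' _ _ hwM
        · exact hB' M n
    _ = _ := by ring

theorem summable_wellPoisedTerm {q w : ℂ} (hq : ‖q‖ < 1) (hw1 : ‖w‖ ≤ 1)
    (hw : ∀ i : ℕ, 1 - q ^ 3 * w * (q ^ 2) ^ i ≠ 0) : Summable (wellPoisedTerm q w) := by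
  obtain ⟨C, h⟩ := exists_norm_wellPoisedTerm_le hq hw1 hw
  exact Summable.of_norm_bounded ((summable_geometric_of_lt_one (norm_nonneg q) hq).mul_left C)
    fun n => by simpa using h 0 n

theorem wellPoised_shift {q w : ℂ} (hq : ‖q‖ < 1) (hw1 : ‖w‖ ≤ 1)
    (hw : ∀ i : ℕ, 1 - q ^ 3 * w * (q ^ 2) ^ i ≠ 0) :
    (∑' n, wellPoisedTerm q w n) * ((1 - q ^ 3 * w) * (1 - q * w))
      = (∑' n, wellPoisedTerm q (w * q ^ 2) n) * (1 - q ^ 2 * w) ^ 2 := by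
  have hp := norm_sq_lt_one hq
  have hw' : ∀ i : ℕ, 1 - q ^ 3 * (w * q ^ 2) * (q ^ 2) ^ i ≠ 0 := fun i => by
    have := hw (i + 1); rw [pow_succ'] at this; convert this using 2; ring
  have hw1' : ‖w * q ^ 2‖ ≤ 1 := by
    rw [norm_mul]; exact mul_le_one₀ hw1 (norm_nonneg _) hp.le
  have s1 := (summable_wellPoisedTerm hq hw1 hw).mul_right ((1 - q ^ 3 * w) * (1 - q * w))
  have s2 := (summable_wellPoisedTerm hq hw1' hw').mul_right ((1 - q ^ 2 * w) ^ 2)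
  rw [← tsum_mul_right, ← tsum_mul_right, ← sub_eq_zero, ← s1.tsum_sub s2]
  have hs := ((s1.sub s2).hasSum.tendsto_sum_nat).comp (tendsto_add_atTop_nat 1)
  refine tendsto_nhds_unique hs ?_
  simp only [Function.comp_def, wellPoised_telescope hq hw]
  obtain ⟨A, hA, hA'⟩ := exists_norm_shiftedNum_le hq
  obtain ⟨B, hB, hB'⟩ := exists_norm_inv_qPochhammer_le hp hw
  refine squeeze_zero_norm
    (a := fun N => ‖q‖ * ‖w‖ * ‖1 - q ^ 3 * w‖ * 2 * (A * B) * ‖q‖ ^ N) (fun N => ?_) ?_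
  · rw [norm_neg, div_eq_mul_inv]
    simp only [norm_mul, norm_pow]
    calc _ ≤ ‖q‖ ^ (N + 1) * ‖w‖ * ‖1 - q ^ 3 * w‖ * 2 * (A * B) := by
          gcongr
          · exact norm_one_sub_pow_le hq _
          · exact hA' _ _ hw1
          · exact hB' _
      _ = _ := by ring
  · simpa using (tendsto_pow_atTop_nhds_zero_of_lt_one (norm_nonneg q) hq).const_mul
      (‖q‖ * ‖w‖ * ‖1 - q ^ 3 * w‖ * 2 * (A * B))

theorem wellPoised_shift_iterate {q w : ℂ} (hq : ‖q‖ < 1) (hw1 : ‖w‖ ≤ 1)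
    (hw : ∀ i : ℕ, 1 - q ^ 3 * w * (q ^ 2) ^ i ≠ 0) (M : ℕ) :
    (∑' n, wellPoisedTerm q w n) *
        (qPochhammer (q ^ 3 * w) (q ^ 2) M * qPochhammer (q * w) (q ^ 2) M)
      = (∑' n, wellPoisedTerm q (w * (q ^ 2) ^ M) n) * qPochhammer (q ^ 2 * w) (q ^ 2) M ^ 2 := by
  induction M with
  | zero => simp [qPochhammer_zero]
  | succ M ih =>
    have hw' : ∀ i : ℕ, 1 - q ^ 3 * (w * (q ^ 2) ^ M) * (q ^ 2) ^ i ≠ 0 := fun i => by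
      have := hw (M + i); rw [pow_add] at this; convert this using 2; ring
    have hw1' : ‖w * (q ^ 2) ^ M‖ ≤ 1 := by
      rw [norm_mul, norm_pow]
      exact mul_le_one₀ hw1 (by positivity) (pow_le_one₀ (norm_nonneg _) (norm_sq_lt_one hq).le)
    have h := wellPoised_shift hq hw1' hw'
    rw [mul_assoc w, ← pow_succ] at h
    simp only [qPochhammer_succ]
    linear_combination (1 - q ^ 3 * w * (q ^ 2) ^ M) * (1 - q * w * (q ^ 2) ^ M) * ih +
      qPochhammer (q ^ 2 * w) (q ^ 2) M ^ 2 * h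

/-- The value of the well-poised series at `w`, in terms of its value at `0`. -/
theorem wellPoised_eq {q w : ℂ} (hq : ‖q‖ < 1) (hw1 : ‖w‖ ≤ 1)
    (hw : ∀ i : ℕ, 1 - q ^ 3 * w * (q ^ 2) ^ i ≠ 0) :
    (∑' n, wellPoisedTerm q w n) *
        (qPochhammerInf (q ^ 3 * w) (q ^ 2) * qPochhammerInf (q * w) (q ^ 2))
      = (∑' n, wellPoisedTerm q 0 n) * qPochhammerInf (q ^ 2 * w) (q ^ 2) ^ 2 := by
  have hp := norm_sq_lt_one hq
  have hlim : Tendsto (fun M => ∑' n, wellPoisedTerm q (w * (q ^ 2) ^ M) n) atTop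
      (𝓝 (∑' n, wellPoisedTerm q 0 n)) := by
    obtain ⟨C, hC⟩ := exists_norm_wellPoisedTerm_le hq hw1 hw
    refine tendsto_tsum_of_dominated_convergence
      ((summable_geometric_of_lt_one (norm_nonneg q) hq).mul_left C) (fun n => ?_)
      (Eventually.of_forall fun M n => hC M n)
    have h0 : Tendsto (fun M : ℕ => w * (q ^ 2) ^ M) atTop (𝓝 0) := by
      simpa using (tendsto_pow_atTop_nhds_zero_of_norm_lt_one hp).const_mul w
    have hc : ContinuousAt (fun v => wellPoisedTerm q v n) 0 := by
      have hd : (∏ i ∈ Finset.range n, (1 - q ^ 3 * (0 : ℂ) * (q ^ 2) ^ i)) ≠ 0 := by simp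
      unfold wellPoisedTerm shiftedNum qPochhammer
      exact continuousAt_const.mul (ContinuousAt.div (by fun_prop) (by fun_prop) hd)
    exact hc.tendsto.comp h0
  refine tendsto_nhds_unique (((tendsto_qPochhammer _ hp).mul (tendsto_qPochhammer _ hp)).const_mul
    (∑' n, wellPoisedTerm q w n)) ?_
  simp only [wellPoised_shift_iterate hq hw1 hw]
  exact hlim.mul ((tendsto_qPochhammer _ hp).pow 2)

/-- At `w = 1` the well-poised series is the Lambert series, since
`(q; q²)_n / (q³; q²)_n = (1 - q) / (1 - q^{2n+1})`. -/
theorem wellPoisedTerm_one {q : ℂ} (hq : ‖q‖ < 1) (n : ℕ) :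
    wellPoisedTerm q 1 n = (1 - q) * lambertTerm q n := by
  have h1 : 1 - q ≠ 0 := one_sub_ne_zero_of_norm_lt_one hq
  have hn : 1 - q ^ (2 * n + 1) ≠ 0 := one_sub_pow_ne_zero hq (by omega)
  have hP := qPochhammer_ne_zero (odd_factor_ne_zero' hq) n
  have hquot : qPochhammer q (q ^ 2) n / qPochhammer (q ^ 3) (q ^ 2) n
      = (1 - q) / (1 - q ^ (2 * n + 1)) := by
    rw [div_eq_div_iff hP hn]
    have h := qPochhammer_succ q (q ^ 2) n
    rw [qPochhammer_succ', ← pow_succ', ← pow_mul, ← pow_succ'] at h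
    exact h.symm
  rw [wellPoisedTerm, shiftedNum_one, mul_one, hquot, lambertTerm]
  field_simp

/-- At `w = q` every term after the first vanishes. -/
theorem tsum_wellPoisedTerm_self {q : ℂ} :
    ∑' n, wellPoisedTerm q q n = (1 + q) / (1 - q) := by
  rw [tsum_eq_single 0]
  · simp [wellPoisedTerm, shiftedNum, qPochhammer_zero]
  · intro n hn
    obtain ⟨k, rfl⟩ := Nat.exists_eq_succ_of_ne_zero hn
    simp [wellPoisedTerm, shiftedNum_self_succ]

theorem qPochhammerInf_succ (a : ℂ) {p : ℂ} (hp : ‖p‖ < 1) :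
    qPochhammerInf a p = (1 - a) * qPochhammerInf (a * p) p := by
  rw [← qPochhammer_mul_qPochhammerInf a hp 1]; simp [qPochhammer]

/-- The Lambert series is the fourth power of Gauss's product `(q²;q²)_∞ / (q;q²)_∞`. -/
theorem tsum_lambertTerm {q : ℂ} (hq : ‖q‖ < 1) :
    ∑' n, lambertTerm q n
      = qPochhammerInf (q ^ 2) (q ^ 2) ^ 4 / qPochhammerInf q (q ^ 2) ^ 4 := by
  have hp := norm_sq_lt_one hq
  have h1 : 1 - q ≠ 0 := one_sub_ne_zero_of_norm_lt_one hq
  have hA : qPochhammerInf q (q ^ 2) ≠ 0 := qPochhammerInf_ne_zero hp (odd_factor_ne_zero hq)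
  have hB : qPochhammerInf (q ^ 2) (q ^ 2) ≠ 0 := qPochhammerInf_ne_zero hp fun i => by
    rw [← pow_succ', ← pow_mul]; exact one_sub_pow_ne_zero hq (by omega)
  have eA := qPochhammerInf_succ q hp
  have eB := qPochhammerInf_succ (q ^ 2) hp
  rw [← pow_succ'] at eA
  rw [← pow_add] at eB
  norm_num at eA eB
  have r1 := wellPoised_eq (w := 1) hq (by simp) (by simpa using odd_factor_ne_zero' hq)
  have r2 := wellPoised_eq (w := q) hq hq.le fun i => by
    rw [← pow_succ, ← pow_mul, ← pow_add]; exact one_sub_pow_ne_zero hq (by omega)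
  simp only [wellPoisedTerm_one hq, tsum_mul_left, mul_one] at r1
  rw [tsum_wellPoisedTerm_self, ← pow_succ, ← pow_succ, ← sq] at r2
  norm_num at r2
  have hA' : qPochhammerInf (q ^ 3) (q ^ 2) ≠ 0 := fun h => hA (by rw [eA, h, mul_zero])
  rw [eA] at r1 ⊢
  rw [eB] at r1 r2 ⊢
  have hD : qPochhammerInf (q ^ 4) (q ^ 2) ≠ 0 := fun h => hB (by rw [eB, h, mul_zero])
  generalize qPochhammerInf (q ^ 3) (q ^ 2) = A at *
  generalize qPochhammerInf (q ^ 4) (q ^ 2) = D at *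
  generalize ∑' n, wellPoisedTerm q 0 n = f at *
  generalize ∑' n, lambertTerm q n = Λ at *
  rw [eq_div_iff (by positivity)]
  have hf : f = (1 + q) / (1 - q) * (D * ((1 - q ^ 2) * D)) / A ^ 2 := by
    rw [eq_div_iff (by positivity)]; exact r2.symm
  -- comparing the values at `w = 1` and `w = q` eliminates the series at `0`
  rw [hf] at r1
  field_simp at r1
  linear_combination (1 - q) * r1

theorem summable_lambertTerm {q : ℂ} (hq : ‖q‖ < 1) : Summable (lambertTerm q) := by
  have h1 : 1 - q ≠ 0 := one_sub_ne_zero_of_norm_lt_one hq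
  have h := summable_wellPoisedTerm (w := 1) hq (by simp) (by simpa using odd_factor_ne_zero' hq)
  simpa only [funext (wellPoisedTerm_one hq), summable_mul_left_iff h1] using h

/-! ### The accelerated series -/

/-- The accelerated series is, term by term, `(1 - q)²` times the row `m = 1` of `wzF`. -/
theorem wzF_one {q : ℂ} (hq : ‖q‖ < 1) (k : ℕ) :
    (1 - q) ^ 2 * wzF q k 1 = q ^ ((k ^ 2 + 5 * k + 2) / 2)
      * (qNumber q (3 * k + 4) / qNumber q (2 * k + 3) ^ 2)
      * (qPochhammer q q k ^ 3 * qPochhammer (-q) q k / qPochhammer (q ^ 3) (q ^ 2) k ^ 3) := by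
  have h1 : 1 - q ≠ 0 := one_sub_ne_zero_of_norm_lt_one hq
  have hk : 1 - q ^ (2 * k + 3) ≠ 0 := one_sub_pow_ne_zero hq (by omega)
  have hP := qPochhammer_ne_zero (odd_factor_ne_zero' hq) k
  have hexp : (k ^ 2 + 5 * k + 2) / 2 = 1 * (2 * k + 1) + k * (k + 1) / 2 := by
    rw [show k ^ 2 + 5 * k + 2 = k * (k + 1) + (2 * k + 1) * 2 by ring,
      Nat.add_mul_div_right _ _ two_pos]
    ring
  -- `(q; q)_k (-q; q)_k = (q²; q²)_k`
  have hsq : qPochhammer (q ^ 2) (q ^ 2) k = qPochhammer q q k * qPochhammer (-q) q k := by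
    simp only [qPochhammer, ← Finset.prod_mul_distrib]
    exact Finset.prod_congr rfl fun i _ => by ring
  have hlast : qPochhammer (q * (q ^ 2) ^ 1) (q ^ 2) (k + 1)
      = qPochhammer (q ^ 3) (q ^ 2) k * (1 - q ^ (2 * k + 3)) := by
    rw [show q * (q ^ 2) ^ 1 = q ^ 3 by ring, qPochhammer_succ]; ring
  rw [wzF, wzKernel, hlast, hsq, hexp, qNumber, qNumber,
    show 3 * k + 2 * 1 + 2 = 3 * k + 4 by ring]
  field_simp

theorem mainTheorem5 (q : ℂ) (hq0 : q ≠ 0) (hq1 : ‖q‖ < 1) :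
    HasSum
      (fun k : ℕ =>
        q ^ ((k ^ 2 + 5 * k + 2) / 2)
          * (qNumber q (3 * k + 4) / qNumber q (2 * k + 3) ^ 2)
          * (qPochhammer q q k ^ 3 * qPochhammer (-q) q k / qPochhammer (q ^ 3) (q ^ 2) k ^ 3))
      ((1 - q) ^ 2 * (qPochhammerInf (q ^ 2) (q ^ 2) ^ 4 / qPochhammerInf q (q ^ 2) ^ 4)
        - (1 + q)) := by
  have h1 : 1 - q ≠ 0 := one_sub_ne_zero_of_norm_lt_one hq1
  have h := (summable_wzF hq1 1).hasSum.mul_left ((1 - q) ^ 2)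
  simp only [wzF_one hq1] at h
  -- the series is the Lambert series without its first term `(1 + q) / (1 - q)²`
  have hz : ∑' n, wzF q n 0 = ∑' n, lambertTerm q n :=
    tendsto_nhds_unique (tendsto_sum_lambertTerm hq1)
      (summable_lambertTerm hq1).hasSum.tendsto_sum_nat
  have hd := tsum_wzF_sub hq1 0
  rw [hz, tsum_lambertTerm hq1] at hd
  have hv : ∑' n, wzF q n 1 = qPochhammerInf (q ^ 2) (q ^ 2) ^ 4 / qPochhammerInf q (q ^ 2) ^ 4
      - lambertTerm q 0 := by linear_combination -hd
  rw [hv, lambertTerm] at h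
  simp only [pow_zero, mul_zero, zero_add, pow_one, one_mul] at h
  rwa [mul_sub, mul_div_cancel₀ _ (pow_ne_zero 2 h1)] at h
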